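/- Let $N\ge 0$ and let $B=e^{-S}\colon\mathbb C^N\to\mathbb C$ be a holomorphic Boltzmann factor (zeros of $B$ are allowed). Some coordinates may be periodic: let $T\in\mathbb R^N$, where $T_i=0$ means that $z_i$ is not periodic, assume that $B$ is invariant under all translations by $(k_1T_1,\dots,k_NT_N)$, $k\in\mathbb Z^N$, and let $M$ be the quotient of $\mathbb C^N$ by these translations (so $M=\mathbb C^N$ if $T=0$). Put $\omega=B\,dz_1\wedge\dots\wedge dz_N$, and for an $N$-form $\beta$ let $|\beta|$ be the absolute form $|\beta|(v_1,\dots,v_N)=|\beta(v_1,\dots,v_N)|$, for real tangent vectors $v_i\in\mathbb C^N$. A contour is an $N$-chain $\gamma=\sum_\sigma c_\sigma\sigma$ with integer coefficients, of possibly infinitely many smooth singular cubes in $M$, represented by their lifts to $\mathbb C^N$, and $$\int_\gamma\beta=\sum_\sigma c_\sigma\int_\sigma\beta,\qquad \int_\gamma|\beta|=\sum_\sigma|c_\sigma|\int_\sigma|\beta|,\qquad Z_Q(\gamma)=\int_\gamma|\omega|\in[0,\infty].$$ Let $\gamma_0$ be a contour (the physical one, for instance $\mathbb R^N$ or a torus)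 with $Z_Q(\gamma_0)<\infty$, and let $Z=\int_{\gamma_0}\omega$. Contours $\gamma$ and $\gamma_0$ are called homologous if they differ by a boundary up to a remainder at infinity that is negligible for $|\omega|$: for every compact $K$ and every $\varepsilon>0$ there is a finite $(N+1)$-chain $\Omega$ such that, in the chain group of $M$ (cubical chains modulo degenerate cubes), $\gamma-\gamma_0-\partial\Omega$ is represented by a chain $R$ lying outside $K$ with $\int_R|\omega|\le\varepsilon$. (If $\gamma-\gamma_0=\partial\Omega$ with $\Omega$ finite, this holds with $R=0$.) Let $\alpha$ be a continuous complex-valued $N$-form on $M$ that is closed, that is, $d\alpha=0$ in the sense of distributions (for a $C^1$ form: the exterior derivative vanishes), with $|\alpha|\le|\omega|$ at every point and on all $N$-tuples of tangent vectors. Then $\int_{\gamma_0}\alpha$ converges absolutely, and for every contour $\gamma$ homologous to $\gamma_0$: 1. $Z_Q(\gamma)<\infty$ and $\left|\int_{\gamma_0}\alpha\right|\le Z_Q(\gamma)$; 2. $\int_\gamma\omega=Z$, and if $\int_{\gamma_0}\alpha\neq0$, then the average phase $\langle\sigma\rangle_\gamma=\left(\int_\gamma\omega\right)/Z_Q(\gamma)$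 satisfies the bound, independent of $\gamma$, $$|\langle\sigma\rangle_\gamma|\le\frac{|Z|}{\left|\int_{\gamma_0}\alpha\right|}.$$ -/

import Mathlib

open MeasureTheory Set Filter
open scoped ENNReal ContDiff

noncomputable section

namespace QuenchedBounds

/-- Complexified field space `ℂ^N`. -/
abbrev FieldSpace (N : ℕ) : Type := Fin N → ℂ

/-- The translation by the vector `(k₁ T₁, …, k_N T_N)`. The coordinate `z_i` is a periodic field
of period `T i` if `T i ≠ 0`, and an ordinary field if `T i = 0`; the complexified field space is
the quotient of `ℂ^N` by these translations (it is `ℂ^N` itself for `T = 0`). Forms on the quotient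
are invariant forms on `ℂ^N`, and a singular cube in the quotient is a singular cube in `ℂ^N`
up to such a translation. -/
def period {N : ℕ} (T : Fin N → ℝ) (k : Fin N → ℤ) : FieldSpace N :=
  fun i => (k i : ℂ) * (T i : ℂ)

/-- Complex-valued differential `n`-forms on `ℂ^N`, regarded as a real manifold. -/
abbrev DiffForm (N n : ℕ) : Type :=
  FieldSpace N → FieldSpace N [⋀^Fin n]→L[ℝ] ℂ

/-- The constant form `dz₁ ∧ … ∧ dz_N`, that is `(v₁, …, v_N) ↦ det (v₁ | … | v_N)`. -/
def dz (N : ℕ) : FieldSpace N [⋀^Fin N]→L[ℝ] ℂ :=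
  { (Matrix.detRowAlternating (n := Fin N) (R := ℂ)).restrictScalars ℝ with
    cont := Continuous.matrix_det (n := Fin N) (R := ℂ) continuous_id
    map_eq_zero_of_eq' := (Matrix.detRowAlternating (n := Fin N) (R := ℂ)).map_eq_zero_of_eq' }

/-- The form `ω = e^{-S} dz₁ ∧ … ∧ dz_N` with Boltzmann factor `B = e^{-S}`. -/
def boltzmannForm {N : ℕ} (B : FieldSpace N → ℂ) : DiffForm N N :=
  fun z => B z • dz N

/-- A form is closed if `dα = 0` in the sense of distributions: for constant vector fields
`v₀, …, v_n` and every test function `φ`,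
`∫ ∑ᵢ (-1)ⁱ (∂_{vᵢ} φ) α(v₀, …, v̂ᵢ, …, v_n) = 0`.
For a `C¹` form this says that the exterior derivative vanishes; a continuous form need not be
differentiable. -/
def IsClosedForm {N n : ℕ} (α : DiffForm N n) : Prop :=
  ∀ φ : FieldSpace N → ℝ, ContDiff ℝ ∞ φ → HasCompactSupport φ →
    ∀ v : Fin (n + 1) → FieldSpace N,
      ∫ z, ∑ i : Fin (n + 1),
        ((-1 : ℂ) ^ (i : ℕ)) * (fderiv ℝ φ z (v i) : ℂ) * α z (i.removeNth v) = 0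

/-- Smooth singular `n`-cubes in `ℂ^N`: maps on `[0,1]^n` with a smooth extension to `ℝ^n`. -/
@[ext]
structure SmoothCube (N n : ℕ) where
  toFun : (Fin n → unitInterval) → FieldSpace N
  smooth : ∃ f : (Fin n → ℝ) → FieldSpace N,
    ContDiff ℝ ∞ f ∧ ∀ t, f (fun i => (t i : ℝ)) = toFun t

namespace SmoothCube

variable {N n : ℕ}

/-- The cube as a function on `ℝ^n`; only its values on `[0,1]^n` matter. -/
def extend (σ : SmoothCube N n) (t : Fin n → ℝ) : FieldSpace N :=
  σ.toFun fun i => Set.projIcc (0 : ℝ) 1 zero_le_one (t i)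

/-- The tangent vector `∂σ/∂t_i` at a point `t` of `[0,1]^n`. -/
def tangent (σ : SmoothCube N n) (t : Fin n → ℝ) (i : Fin n) : FieldSpace N :=
  fderivWithin ℝ σ.extend (Set.Icc 0 1) t (Pi.single i 1)

/-- The restriction of a cube to the face `t_i = ε`. -/
def face (σ : SmoothCube N (n + 1)) (i : Fin (n + 1)) (ε : unitInterval) : SmoothCube N n where
  toFun t := σ.toFun (i.insertNth ε t)
  smooth := by
    obtain ⟨f, hf, h⟩ := σ.smooth
    refine ⟨fun t => f (i.insertNth (ε : ℝ) t), hf.comp ?_, fun t => ?_⟩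
    · rw [contDiff_pi]
      intro j
      refine Fin.succAboveCases i ?_ (fun j => ?_) j
      · simpa using contDiff_const
      · simpa using contDiff_apply ℝ ℝ j
    · rw [← h]
      refine congrArg f (funext fun j => ?_)
      refine Fin.succAboveCases i ?_ (fun j => ?_) j <;> simp

/-- The cube moved by a constant vector. -/
def translate (σ : SmoothCube N n) (w : FieldSpace N) : SmoothCube N n where
  toFun t := σ.toFun t + w
  smooth := by
    obtain ⟨f, hf, h⟩ := σ.smooth
    exact ⟨fun t => f t + w, hf.add contDiff_const, fun t => by simp only [h]⟩

/-- A cube is degenerate if it does not depend on one of its parameters. -/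
def IsDegenerate (σ : SmoothCube N n) : Prop :=
  ∃ i : Fin n, ∀ t s, σ.toFun (Function.update t i s) = σ.toFun t

/-- The integral `∫_σ β` of an `n`-form over a cube. -/
def integral (β : DiffForm N n) (σ : SmoothCube N n) : ℂ :=
  ∫ t in Set.Icc (0 : Fin n → ℝ) 1, β (σ.extend t) (σ.tangent t)

/-- The integral `∫_σ |β|` of the absolute form `|β|(v₁, …, v_n) = |β(v₁, …, v_n)|` over a cube. -/
def absIntegral (β : DiffForm N n) (σ : SmoothCube N n) : ℝ≥0∞ :=
  ∫⁻ t in Set.Icc (0 : Fin n → ℝ) 1, ‖β (σ.extend t) (σ.tangent t)‖ₑ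

/-- The boundary `∑ᵢ (-1)ⁱ (σ|_{tᵢ = 1} - σ|_{tᵢ = 0})`, with `i` counted from `0`. -/
def boundary (σ : SmoothCube N (n + 1)) : SmoothCube N n →₀ ℤ :=
  ∑ i : Fin (n + 1), (-1 : ℤ) ^ (i : ℕ) •
    (Finsupp.single (σ.face i 1) 1 - Finsupp.single (σ.face i 0) 1)

end SmoothCube

/-- Finite singular chains with integer coefficients. -/
abbrev FiniteChain (N n : ℕ) : Type := SmoothCube N n →₀ ℤ

/-- The boundary of a finite chain. -/
def boundary {N n : ℕ} (Ω : FiniteChain N (n + 1)) : FiniteChain N n :=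
  Ω.sum fun σ c => c • σ.boundary

/-- The finite chains that represent zero in the (normalized) cubical chain group of the quotient
of `ℂ^N` by the periods: those generated by degenerate cubes and by differences of a cube and its
translate by a period. -/
def nullChains {N n : ℕ} (T : Fin N → ℝ) : AddSubgroup (FiniteChain N n) :=
  AddSubgroup.closure
    ({c | ∃ σ : SmoothCube N n, σ.IsDegenerate ∧ c = Finsupp.single σ 1} ∪
      {c | ∃ (σ : SmoothCube N n) (k : Fin N → ℤ),
        c = Finsupp.single (σ.translate (period T k)) 1 - Finsupp.single σ 1})

/-- Contours of integration: `N`-chains in `ℂ^N` with integer coefficients, made of possibly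
infinitely many cubes, since a contour such as `ℝ^N` is not compact. -/
abbrev Contour (N : ℕ) : Type := SmoothCube N N → ℤ

/-- The integral `∫_γ |β|`, in `[0, ∞]`. It does not depend on the orientation of `γ`. -/
def absIntegral {N : ℕ} (β : DiffForm N N) (γ : Contour N) : ℝ≥0∞ :=
  ∑' σ, ((γ σ).natAbs : ℝ≥0∞) * SmoothCube.absIntegral β σ

/-- The integral `∫_γ β`. It converges absolutely when `∫_γ |β| < ∞`. -/
def contourIntegral {N : ℕ} (β : DiffForm N N) (γ : Contour N) : ℂ :=
  ∑' σ, (γ σ : ℂ) * SmoothCube.integral β σ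

/-- The quenched partition function `Z_Q(γ) = ∫_γ |ω|`. -/
def quenchedPartition {N : ℕ} (B : FieldSpace N → ℂ) (γ : Contour N) : ℝ≥0∞ :=
  absIntegral (boltzmannForm B) γ

/-- The partition function `∫_γ ω`. -/
def partition {N : ℕ} (B : FieldSpace N → ℂ) (γ : Contour N) : ℂ :=
  contourIntegral (boltzmannForm B) γ

/-- The average phase `(∫_γ ω) / Z_Q(γ)` on the contour `γ`. -/
def averagePhase {N : ℕ} (B : FieldSpace N → ℂ) (γ : Contour N) : ℂ :=
  partition B γ / ((quenchedPartition B γ).toReal : ℂ)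

/-- Two contours in the quotient of `ℂ^N` by the periods are homologous if they differ by a
boundary, up to a remainder at infinity that is negligible for `|ω|`: for every compact `K` and
every `ε > 0` there is a finite chain `Ω` such that `γ - γ₀ - ∂Ω` is, modulo null chains, a chain
`R` lying outside `K` with `∫_R |ω| ≤ ε`. If `γ - γ₀` is the boundary of a finite chain, this
holds with `R = 0`. Without a condition at infinity the integral of `ω` is not invariant: the real
line is the boundary of a half-plane. -/
def Homologous {N : ℕ} (T : Fin N → ℝ) (B : FieldSpace N → ℂ) (γ γ₀ : Contour N) : Prop :=
  ∀ K : Set (FieldSpace N), IsCompact K → ∀ ε : ℝ≥0∞, 0 < ε →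
    ∃ (Ω : FiniteChain N (N + 1)) (D : FiniteChain N N) (R : Contour N),
      D ∈ nullChains T ∧
      (∀ σ, γ σ - γ₀ σ = boundary Ω σ + D σ + R σ) ∧
      (∀ σ, R σ ≠ 0 → ∀ t (k : Fin N → ℤ), σ.toFun t + period T k ∉ K) ∧
      quenchedPartition B R ≤ ε

end QuenchedBounds

end

/-! The integral of a closed form dominated by `|ω|` takes the same value on homologous contours:
Stokes removes the boundary, null chains contribute nothing, and the remainder at infinity
contributes at most `∫_R |ω| ≤ ε` (`Homologous.contourIntegral_eq`). Applied to `α` this gives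
`|∫_{γ₀} α| = |∫_γ α| ≤ ∫_γ |α| ≤ ∫_γ |ω| = Z_Q(γ)`. Applied to `ω`, closed because `B` is
holomorphic, it fixes the numerator of the average phase; dividing gives the bound.

The analytic difficulty is Stokes for an `α` that is only continuous. Mollifications of `α` are
differentiable and closed, so the divergence theorem applies to their pullbacks, and their integrals
over cubes converge to those of `α` (`chainIntegral_boundary_cube_of_isClosedForm`). -/

namespace QuenchedBounds

open scoped Topology Convolution

/-! ### Integrals over a single cube. -/

namespace SmoothCube

variable {N n : ℕ}

theorem extend_eq_of_mem (σ : SmoothCube N n) {f : (Fin n → ℝ) → FieldSpace N}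
    (hf : ∀ t : Fin n → unitInterval, f (fun i => (t i : ℝ)) = σ.toFun t) {t : Fin n → ℝ}
    (ht : t ∈ Icc (0 : Fin n → ℝ) 1) : σ.extend t = f t := by
  rw [extend, ← hf]
  congr 1
  funext i
  rw [projIcc_of_mem zero_le_one ⟨ht.1 i, ht.2 i⟩]

theorem uniqueDiffOn_unitCube : UniqueDiffOn ℝ (Icc (0 : Fin n → ℝ) 1) := by
  rw [← pi_univ_Icc]
  exact UniqueDiffOn.univ_pi fun i => uniqueDiffOn_Icc (by simp)

theorem tangent_eq_of_mem (σ : SmoothCube N n) {f : (Fin n → ℝ) → FieldSpace N}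
    (hs : ContDiff ℝ ∞ f)
    (hf : ∀ t : Fin n → unitInterval, f (fun i => (t i : ℝ)) = σ.toFun t) {t : Fin n → ℝ}
    (ht : t ∈ Icc (0 : Fin n → ℝ) 1) :
    σ.tangent t = fun i => fderiv ℝ f t (Pi.single i 1) := by
  funext i
  rw [tangent, fderivWithin_congr (fun s hs => σ.extend_eq_of_mem hf hs) (σ.extend_eq_of_mem hf ht),
    fderivWithin_eq_fderiv (uniqueDiffOn_unitCube t ht) (hs.differentiable (by simp) t)]

theorem integral_eq (σ : SmoothCube N n) {f : (Fin n → ℝ) → FieldSpace N}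
    (hs : ContDiff ℝ ∞ f)
    (hf : ∀ t : Fin n → unitInterval, f (fun i => (t i : ℝ)) = σ.toFun t) (β : DiffForm N n) :
    σ.integral β =
      ∫ t in Icc (0 : Fin n → ℝ) 1, β (f t) fun i => fderiv ℝ f t (Pi.single i 1) :=
  setIntegral_congr_fun measurableSet_Icc fun t ht => by
    simp only [σ.extend_eq_of_mem hf ht, σ.tangent_eq_of_mem hs hf ht]

theorem absIntegral_eq (σ : SmoothCube N n) {f : (Fin n → ℝ) → FieldSpace N}
    (hs : ContDiff ℝ ∞ f)
    (hf : ∀ t : Fin n → unitInterval, f (fun i => (t i : ℝ)) = σ.toFun t) (β : DiffForm N n) :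
    σ.absIntegral β =
      ∫⁻ t in Icc (0 : Fin n → ℝ) 1, ‖β (f t) fun i => fderiv ℝ f t (Pi.single i 1)‖ₑ :=
  setLIntegral_congr_fun measurableSet_Icc fun t ht => by
    simp only [σ.extend_eq_of_mem hf ht, σ.tangent_eq_of_mem hs hf ht]

theorem continuous_pullback_apply {β : DiffForm N n} (hβ : Continuous β)
    {f : (Fin n → ℝ) → FieldSpace N} (hs : ContDiff ℝ ∞ f) :
    Continuous fun t => β (f t) fun i => fderiv ℝ f t (Pi.single i 1) := by
  have h1 : Continuous fun t => (β (f t)).toContinuousMultilinearMap :=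
    ContinuousAlternatingMap.continuous_toContinuousMultilinearMap.comp (hβ.comp hs.continuous)
  exact h1.eval (continuous_pi fun i => (hs.continuous_fderiv (by simp)).clm_apply continuous_const)

theorem absIntegral_lt_top {β : DiffForm N n} (hβ : Continuous β) (σ : SmoothCube N n) :
    σ.absIntegral β < ⊤ := by
  obtain ⟨f, hs, hf⟩ := σ.smooth
  rw [σ.absIntegral_eq hs hf]
  exact ((continuous_pullback_apply hβ hs).continuousOn.integrableOn_compact isCompact_Icc).2

theorem enorm_integral_le (β : DiffForm N n) (σ : SmoothCube N n) :
    ‖σ.integral β‖ₑ ≤ σ.absIntegral β :=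
  enorm_integral_le_lintegral_enorm _

theorem absIntegral_mono {β β' : DiffForm N n} (h : ∀ z v, ‖β z v‖ ≤ ‖β' z v‖)
    (σ : SmoothCube N n) : σ.absIntegral β ≤ σ.absIntegral β' :=
  lintegral_mono fun _ => enorm_le_iff_norm_le.2 (h _ _)

theorem integral_translate {β : DiffForm N n} {w : FieldSpace N} (hβ : ∀ z, β (z + w) = β z)
    (σ : SmoothCube N n) : (σ.translate w).integral β = σ.integral β := by
  obtain ⟨f, hs, hf⟩ := σ.smooth
  rw [σ.integral_eq hs hf, (σ.translate w).integral_eq (f := fun t => f t + w)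
    (hs.add contDiff_const) fun t => by rw [hf]; rfl]
  simp only [hβ, fderiv_add_const]

/-- One tangent vector vanishes at every point of the cube, so the pulled-back form does too. -/
theorem IsDegenerate.integral_eq_zero {σ : SmoothCube N n} (hσ : σ.IsDegenerate)
    (β : DiffForm N n) : σ.integral β = 0 := by
  obtain ⟨i, hi⟩ := hσ
  refine setIntegral_eq_zero_of_forall_eq_zero fun t ht => ?_
  refine (β (σ.extend t)).map_coord_zero i ?_
  have hext : ∀ s : ℝ, σ.extend (Function.update t i s) = σ.extend t := fun s => by
    rw [extend, extend, ← hi (fun j => projIcc 0 1 zero_le_one (t j)) (projIcc 0 1 zero_le_one s)]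
    congr 1
    funext j
    by_cases hj : j = i
    · subst hj; simp
    · simp [hj]
  obtain ⟨f, hs, hf⟩ := σ.smooth
  -- A one-sided derivative along the `i`-th edge direction, so that `t` may lie on the boundary of
  -- the cube; the curve is constant by `hext`.
  have hd : HasDerivWithinAt (fun s : ℝ => σ.extend (Function.update t i s))
      (σ.tangent t i) (Icc 0 1) (t i) := by
    have h1 : HasFDerivWithinAt σ.extend (fderivWithin ℝ σ.extend (Icc 0 1) t) (Icc 0 1)
        (Function.update t i (t i)) := by
      rw [Function.update_eq_self]
      exact ((hs.differentiable (by simp) t).differentiableWithinAt.congr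
        (fun s hs => σ.extend_eq_of_mem hf hs) (σ.extend_eq_of_mem hf ht)).hasFDerivWithinAt
    refine h1.comp_hasDerivWithinAt (t i) (hasDerivAt_update t i (t i)).hasDerivWithinAt
      fun s hs => ⟨fun j => ?_, fun j => ?_⟩
    · by_cases hj : j = i
      · subst hj; simpa using hs.1
      · simpa [hj] using ht.1 j
    · by_cases hj : j = i
      · subst hj; simpa using hs.2
      · simpa [hj] using ht.2 j
  simp only [hext] at hd
  exact (uniqueDiffOn_Icc_zero_one _ ⟨ht.1 i, ht.2 i⟩).eq_deriv _ hd (hasDerivWithinAt_const _ _ _)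

end SmoothCube

/-! ### Stokes for differentiable closed forms. -/

variable {N n : ℕ}

/-- The integral of a form over a finite chain. -/
noncomputable def chainIntegral (β : DiffForm N n) : FiniteChain N n →+ ℂ :=
  Finsupp.liftAddHom fun σ => (zmultiplesHom ℂ (σ.integral β))

theorem chainIntegral_single (β : DiffForm N n) (σ : SmoothCube N n) (c : ℤ) :
    chainIntegral β (Finsupp.single σ c) = c * σ.integral β := by
  simp [chainIntegral]

theorem chainIntegral_apply (β : DiffForm N n) (c : FiniteChain N n) :
    chainIntegral β c = ∑ σ ∈ c.support, (c σ : ℂ) * σ.integral β := by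
  simp [chainIntegral, Finsupp.sum]

theorem chainIntegral_boundary_cube (β : DiffForm N n) (σ : SmoothCube N (n + 1)) :
    chainIntegral β σ.boundary =
      ∑ i : Fin (n + 1), (-1) ^ (i : ℕ) *
        ((σ.face i 1).integral β - (σ.face i 0).integral β) := by
  simp [SmoothCube.boundary, chainIntegral_single]

/-- Stokes' theorem for a cube and a closed differentiable form whose derivative need not be
continuous. -/
theorem chainIntegral_boundary_cube_of_extDeriv_eq_zero {β : DiffForm N n}
    (hβ : Differentiable ℝ β) (hd : ∀ z, extDeriv β z = 0) (σ : SmoothCube N (n + 1)) :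
    chainIntegral β σ.boundary = 0 := by
  obtain ⟨f, hs, hf⟩ := σ.smooth
  set p : (Fin (n + 1) → ℝ) → (Fin (n + 1) → ℝ) [⋀^Fin n]→L[ℝ] ℂ :=
    fun t => (β (f t)).compContinuousLinearMap (fderiv ℝ f t) with hp
  set e : Fin (n + 1) → Fin (n + 1) → ℝ := fun i => Pi.single i 1 with he
  have hf' : Differentiable ℝ (fderiv ℝ f) :=
    (hs.fderiv_right (m := ∞) (by simp)).differentiable (by simp)
  have hpd : Differentiable ℝ p := by
    have := hβ.comp (hs.differentiable (by simp))
    intro t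
    exact (((this t).hasFDerivAt).continuousAlternatingMapCompContinuousLinearMap
      (hf' t).hasFDerivAt).differentiableAt
  have hpe : ∀ t, extDeriv p t = 0 := fun t => by
    rw [hp, extDeriv_pullback (hβ _) (contDiff_infty.1 hs 2).contDiffAt (by simp), hd]
    rfl
  -- A face integral is the integral of the coefficient of the pullback `p` that omits the `i`-th
  -- basis vector.
  have hface : ∀ (i : Fin (n + 1)) (ε : unitInterval), (σ.face i ε).integral β =
      ∫ t in Icc (0 : Fin n → ℝ) 1, p (i.insertNth (ε : ℝ) t) (i.removeNth e) := by
    intro i ε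
    have hins : ∀ t : Fin n → ℝ, HasFDerivAt
        (fun t : Fin n → ℝ => (i.insertNth (ε : ℝ) t : Fin (n + 1) → ℝ))
        (ContinuousLinearMap.pi fun j => i.insertNth (α := fun _ => (Fin n → ℝ) →L[ℝ] ℝ) 0
          (fun k => ContinuousLinearMap.proj k) j) t := by
      intro t
      rw [hasFDerivAt_pi]
      intro j
      refine Fin.succAboveCases i ?_ (fun k => ?_) j
      · simpa using hasFDerivAt_const _ _
      · simpa using hasFDerivAt_apply k t
    have hsm : ContDiff ℝ ∞ (fun t : Fin n → ℝ => f (i.insertNth (ε : ℝ) t)) := by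
      refine hs.comp (contDiff_pi.2 fun j => ?_)
      refine Fin.succAboveCases i ?_ (fun k => ?_) j
      · simpa using contDiff_const
      · simpa using contDiff_apply ℝ ℝ k
    rw [(σ.face i ε).integral_eq hsm]
    · refine setIntegral_congr_fun measurableSet_Icc fun t _ => ?_
      simp only [hp, ContinuousAlternatingMap.compContinuousLinearMap_apply]
      congr 1
      funext k
      have := ((hs.differentiable (by simp) _).hasFDerivAt.comp t (hins t)).fderiv
      simp only [Function.comp_def] at this
      rw [this]
      simp only [ContinuousLinearMap.comp_apply, Function.comp_apply, Fin.removeNth, he]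
      congr 1
      funext j
      refine Fin.succAboveCases i ?_ (fun l => ?_) j
      · simp
      · simp [Pi.single_apply]
    · intro t
      rw [SmoothCube.face, ← hf]
      refine congrArg f (funext fun j => ?_)
      refine Fin.succAboveCases i ?_ (fun k => ?_) j <;> simp
  rw [chainIntegral_boundary_cube]
  -- The vector field whose divergence is the single coefficient of `dp`.
  set g : Fin (n + 1) → (Fin (n + 1) → ℝ) → ℂ :=
    fun i t => (-1) ^ (i : ℕ) * p t (i.removeNth e) with hg
  have hgd : ∀ i, Differentiable ℝ (g i) := fun i => by
    have : Differentiable ℝ fun t => p t (i.removeNth e) := fun t =>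
      ((hpd t).hasFDerivAt.continuousAlternatingMap_apply_const _).differentiableAt
    exact this.const_mul _
  have hdiv : ∀ t, ∑ i, fderiv ℝ (g i) t (e i) = 0 := fun t => by
    have h0 : extDeriv p t e = 0 := by rw [hpe]; rfl
    rw [← h0, extDeriv_apply (hpd t)]
    refine Finset.sum_congr rfl fun i _ => ?_
    have : DifferentiableAt ℝ (fun t => p t (i.removeNth e)) t :=
      ((hpd t).hasFDerivAt.continuousAlternatingMap_apply_const _).differentiableAt
    rw [hg, fderiv_const_mul this]
    rcases Nat.even_or_odd (i : ℕ) with h | h <;> simp [h.neg_one_pow]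
  -- This version needs only an integrable divergence, and here it is zero; hence no continuity of
  -- the derivative of `β`.
  have key := integral_divergence_of_hasFDerivAt_off_countable' (0 : Fin (n + 1) → ℝ) 1
    (zero_le_one) g (fun i t => fderiv ℝ (g i) t) ∅ countable_empty
    (fun i => (hgd i).continuous.continuousOn) (fun t _ i => (hgd i t).hasFDerivAt)
    (by simp only [he] at hdiv; simp [hdiv])
  simp only [he] at hdiv
  simp only [hdiv, integral_zero] at key
  rw [key]
  refine Finset.sum_congr rfl fun i _ => ?_
  rw [hface, hface, mul_sub, ← integral_const_mul, ← integral_const_mul]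
  rfl

/-! ### Mollification and Stokes for continuous closed forms. -/

/-- Convolution of a form with a smooth probability density. -/
noncomputable def mollify (φ : ContDiffBump (0 : FieldSpace N)) (α : DiffForm N n) : DiffForm N n :=
  φ.normed volume ⋆[ContinuousLinearMap.lsmul ℝ ℝ, volume] α

/-- The derivative falls on the kernel. The integral is written with `g t` and the kernel at `x -
t`, the shape in which `IsClosedForm` can be tested. -/
theorem hasFDerivAt_normed_convolution {E F : Type*} [NormedAddCommGroup E] [NormedSpace ℝ E]
    [FiniteDimensional ℝ E] [MeasureSpace E] [BorelSpace E]
    [(volume : Measure E).IsAddHaarMeasure] [NormedAddCommGroup F] [NormedSpace ℝ F]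
    (φ : ContDiffBump (0 : E)) {g : E → F} (hg : Continuous g) (x : E) :
    Integrable (fun t => (fderiv ℝ (φ.normed volume) (x - t)).smulRight (g t)) ∧
      HasFDerivAt (φ.normed volume ⋆[ContinuousLinearMap.lsmul ℝ ℝ, volume] g)
        (∫ t, (fderiv ℝ (φ.normed volume) (x - t)).smulRight (g t)) x := by
  have hρ : ContDiff ℝ 1 (φ.normed (volume : Measure E)) := φ.contDiff_normed
  have hsupp := φ.hasCompactSupport_normed (μ := (volume : Measure E))
  have hL : ∀ t, (ContinuousLinearMap.lsmul ℝ ℝ).precompL E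
      (fderiv ℝ (φ.normed volume) (x - t)) (g t) =
        (fderiv ℝ (φ.normed volume) (x - t)).smulRight (g t) := fun t => by
    ext w
    simp [ContinuousLinearMap.precompL_apply]
  constructor
  · have := (HasCompactSupport.convolutionExists_left
      ((ContinuousLinearMap.lsmul ℝ ℝ : ℝ →L[ℝ] F →L[ℝ] F).precompL E) (hsupp.fderiv ℝ)
      (hρ.continuous_fderiv (by simp)) (hg.locallyIntegrable (μ := volume)) x).integrable_swap
    exact this.congr (Eventually.of_forall hL)
  · have := hsupp.hasFDerivAt_convolution_left (ContinuousLinearMap.lsmul ℝ ℝ : ℝ →L[ℝ] F →L[ℝ] F)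
      hρ (hg.locallyIntegrable (μ := volume)) x
    rw [convolution_eq_swap] at this
    simpa only [hL] using this

theorem differentiable_mollify (φ : ContDiffBump (0 : FieldSpace N)) {α : DiffForm N n}
    (hα : Continuous α) : Differentiable ℝ (mollify φ α) :=
  fun x => (hasFDerivAt_normed_convolution φ hα x).2.differentiableAt

/-- For fixed `x` the function `t ↦ ρ(x - t)`, with `ρ` the normalized bump, is a test function, and
distributional closedness against it is the vanishing of the exterior derivative at `x`. -/
theorem extDeriv_mollify (φ : ContDiffBump (0 : FieldSpace N)) {α : DiffForm N n}
    (hα : Continuous α) (hc : IsClosedForm α) (x : FieldSpace N) :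
    extDeriv (mollify φ α) x = 0 := by
  ext v
  have hρ : ContDiff ℝ ∞ (φ.normed (volume : Measure (FieldSpace N))) := φ.contDiff_normed
  obtain ⟨hint, hfd⟩ := hasFDerivAt_normed_convolution φ hα x
  -- Antisymmetrization followed by evaluation at `v`: continuous and linear, so it passes under the
  -- integral.
  set Λ : (FieldSpace N →L[ℝ] FieldSpace N [⋀^Fin n]→L[ℝ] ℂ) →L[ℝ] ℂ :=
    (ContinuousAlternatingMap.apply ℝ (FieldSpace N) ℂ v).comp
      (ContinuousAlternatingMap.alternatizeUncurryFinCLM ℝ (FieldSpace N) ℂ) with hΛ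
  have h1 : extDeriv (mollify φ α) x v = Λ (fderiv ℝ (mollify φ α) x) := rfl
  rw [h1, mollify, hfd.fderiv, ← Λ.integral_comp_comm hint]
  have h2 := hc (fun t => φ.normed volume (x - t)) (hρ.comp (contDiff_const.sub contDiff_id))
    (φ.hasCompactSupport_normed.comp_homeomorph (Homeomorph.subLeft x)) v
  rw [ContinuousAlternatingMap.coe_zero, Pi.zero_apply, ← neg_eq_zero, ← integral_neg, ← h2]
  refine integral_congr_ae (Eventually.of_forall fun t => ?_)
  -- The reflection `t ↦ x - t` produces the sign introduced by `neg_eq_zero` above.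
  have h3 : ∀ w, fderiv ℝ (fun t => φ.normed volume (x - t)) t w =
      - fderiv ℝ (φ.normed volume) (x - t) w := fun w => by
    have := ((hρ.differentiable (by simp) (x - t)).hasFDerivAt.comp t
      ((hasFDerivAt_const x t).sub (hasFDerivAt_id t))).fderiv
    simp only [Function.comp_def] at this
    rw [this]
    simp
  simp only [h3, hΛ, ContinuousLinearMap.comp_apply,
    ContinuousAlternatingMap.alternatizeUncurryFinCLM_apply, ContinuousAlternatingMap.apply_apply,
    ContinuousAlternatingMap.alternatizeUncurryFin_apply, ← Finset.sum_neg_distrib]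
  refine Finset.sum_congr rfl fun i _ => ?_
  rcases Nat.even_or_odd (i : ℕ) with h | h <;> simp [h.neg_one_pow]

theorem tendsto_integral_mollify {φ : ℕ → ContDiffBump (0 : FieldSpace N)}
    (hφ : Tendsto (fun k => (φ k).rOut) atTop (𝓝 0)) (hφ1 : ∀ k, (φ k).rOut ≤ 1)
    {α : DiffForm N n} (hα : Continuous α) (σ : SmoothCube N n) :
    Tendsto (fun k => σ.integral (mollify (φ k) α)) atTop (𝓝 (σ.integral α)) := by
  obtain ⟨f, hs, hf⟩ := σ.smooth
  simp only [σ.integral_eq hs hf]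
  set τ : (Fin n → ℝ) → Fin n → FieldSpace N := fun t i => fderiv ℝ f t (Pi.single i 1) with hτ
  have hτc : Continuous τ :=
    continuous_pi fun i => (hs.continuous_fderiv (by simp)).clm_apply continuous_const
  -- Radii at most `1` keep all averages inside the compact closed `1`-neighbourhood of the image,
  -- which gives a uniform bound for dominated convergence.
  obtain ⟨C, hC⟩ : ∃ C, ∀ z ∈ Metric.cthickening 1 (f '' Icc 0 1), ‖α z‖ ≤ C :=
    (isCompact_Icc.image hs.continuous).cthickening.exists_bound_of_continuousOn hα.continuousOn
  have hbound : ∀ k, ∀ t ∈ Icc (0 : Fin n → ℝ) 1, ‖mollify (φ k) α (f t)‖ ≤ C := fun k t ht => by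
    have hft : ∀ z ∈ Metric.ball (f t) (φ k).rOut, ‖α z‖ ≤ C := fun z hz =>
      hC z (Metric.mem_cthickening_of_dist_le z (f t) 1 _ (mem_image_of_mem f ht)
        ((Metric.mem_ball.1 hz).le.trans (hφ1 k)))
    rw [← dist_zero_right]
    refine dist_convolution_le ((norm_nonneg _).trans (hft _ (Metric.mem_ball_self (φ k).rOut_pos)))
      (φ k).support_normed_eq.subset (φ k).nonneg_normed (φ k).integral_normed
      hα.aestronglyMeasurable fun z hz => ?_
    rw [dist_zero_right]
    exact hft z hz
  refine tendsto_integral_of_dominated_convergence (fun t => C * ∏ i, ‖τ t i‖) (fun k => ?_) ?_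
    (fun k => ?_) ?_
  · exact (SmoothCube.continuous_pullback_apply (differentiable_mollify _ hα).continuous
      hs).aestronglyMeasurable
  · exact (continuous_const.mul (continuous_finsetProd _ fun i _ =>
      ((continuous_apply i).comp hτc).norm)).integrableOn_Icc
  · refine (ae_restrict_iff' measurableSet_Icc).2 (Eventually.of_forall fun t ht => ?_)
    exact ((mollify (φ k) α (f t)).le_opNorm _).trans
      (mul_le_mul_of_nonneg_right (hbound k t ht) (by positivity))
  · refine Eventually.of_forall fun t => ?_
    exact ((ContinuousAlternatingMap.apply ℝ (FieldSpace N) ℂ (τ t)).continuous.tendsto _).comp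
      (ContDiffBump.convolution_tendsto_right_of_continuous hφ hα (f t))

/-- Stokes' theorem for a cube and a continuous form that is closed in the sense of
distributions. -/
theorem chainIntegral_boundary_cube_of_isClosedForm {α : DiffForm N n}
    (hα : Continuous α) (hc : IsClosedForm α) (σ : SmoothCube N (n + 1)) :
    chainIntegral α σ.boundary = 0 := by
  have hr : ∀ k : ℕ, (0 : ℝ) < 1 / ((k : ℝ) + 1) := fun k => Nat.one_div_pos_of_nat
  let φ : ℕ → ContDiffBump (0 : FieldSpace N) := fun k =>
    ⟨1 / ((k : ℝ) + 1) / 2, 1 / ((k : ℝ) + 1), half_pos (hr k), half_lt_self (hr k)⟩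
  have hφ : Tendsto (fun k => (φ k).rOut) atTop (𝓝 0) := tendsto_one_div_add_atTop_nhds_zero_nat
  have hφ1 : ∀ k, (φ k).rOut ≤ 1 := fun k => by
    refine (div_le_one (by positivity)).2 ?_
    linarith [(Nat.cast_nonneg k : (0 : ℝ) ≤ k)]
  have hlim : Tendsto (fun k => chainIntegral (mollify (φ k) α) σ.boundary) atTop
      (𝓝 (chainIntegral α σ.boundary)) := by
    simp only [chainIntegral_apply]
    exact tendsto_finsetSum _ fun τ _ => (tendsto_integral_mollify hφ hφ1 hα τ).const_mul _
  refine tendsto_nhds_unique hlim ?_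
  simp only [chainIntegral_boundary_cube_of_extDeriv_eq_zero
    (differentiable_mollify _ hα) (extDeriv_mollify _ hα hc)]
  exact tendsto_const_nhds

/-! ### Closedness of `ω`. -/

/-- A complex linear form `ℓ` on `ℂ^N` satisfies `ℓ ∧ dz₁ ∧ … ∧ dz_N = 0`. -/
theorem sum_apply_mul_dz_eq_zero (l : FieldSpace N →ₗ[ℂ] ℂ) (v : Fin (N + 1) → FieldSpace N) :
    ∑ i : Fin (N + 1), (-1) ^ (i : ℕ) * l (v i) * dz N (i.removeNth v) = 0 := by
  -- The sum is the expansion of `det A` along its first column, which is a linear combination of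
  -- the others.
  let A : Matrix (Fin (N + 1)) (Fin (N + 1)) ℂ := Matrix.of fun i => Fin.cons (l (v i)) (v i)
  have hA : A.det = ∑ i : Fin (N + 1), (-1) ^ (i : ℕ) * l (v i) * dz N (i.removeNth v) := by
    rw [Matrix.det_succ_column_zero]
    rfl
  rw [← hA, ← Matrix.exists_mulVec_eq_zero_iff]
  refine ⟨Fin.cons (-1) fun j => l (Pi.single j 1), fun h => ?_, ?_⟩
  · simpa using congrFun h 0
  · funext i
    have : l (v i) = ∑ j, v i j * l (Pi.single j 1) := by
      conv_lhs => rw [← Finset.univ_sum_single (v i)]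
      rw [map_sum]
      refine Finset.sum_congr rfl fun j _ => ?_
      rw [← smul_eq_mul, ← map_smul, ← Pi.single_smul, smul_eq_mul, mul_one]
    simp [A, Matrix.mulVec, dotProduct, Fin.sum_univ_succ, ← this]

theorem differentiable_boltzmannForm {B : FieldSpace N → ℂ} (hB : Differentiable ℂ B) :
    Differentiable ℝ (boltzmannForm B) :=
  (hB.restrictScalars ℝ).smul_const (dz N)

/-- Holomorphy makes `dB` complex linear, so `dB ∧ dz₁ ∧ … ∧ dz_N = 0`. -/
theorem extDeriv_boltzmannForm {B : FieldSpace N → ℂ} (hB : Differentiable ℂ B)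
    (z : FieldSpace N) : extDeriv (boltzmannForm B) z = 0 := by
  ext v
  rw [extDeriv_apply (differentiable_boltzmannForm hB z), ContinuousAlternatingMap.coe_zero,
    Pi.zero_apply, ← sum_apply_mul_dz_eq_zero (fderiv ℂ B z).toLinearMap v]
  refine Finset.sum_congr rfl fun i _ => ?_
  have h : HasFDerivAt (fun x => boltzmannForm B x (i.removeNth v))
      (((fderiv ℂ B z).restrictScalars ℝ).smulRight (dz N (i.removeNth v))) z :=
    ((hB z).hasFDerivAt.restrictScalars ℝ).smul_const _
  rw [h.fderiv]
  rcases Nat.even_or_odd (i : ℕ) with h | h <;> simp [h.neg_one_pow]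

/-! ### Finite chains and infinite contours. -/

theorem chainIntegral_boundary {β : DiffForm N n}
    (h : ∀ σ : SmoothCube N (n + 1), chainIntegral β σ.boundary = 0)
    (Ω : FiniteChain N (n + 1)) : chainIntegral β (boundary Ω) = 0 := by
  rw [boundary, Finsupp.sum, map_sum]
  exact Finset.sum_eq_zero fun σ _ => by rw [map_zsmul, h, smul_zero]

theorem chainIntegral_of_mem_nullChains {T : Fin N → ℝ} {β : DiffForm N n}
    (hβ : ∀ (k : Fin N → ℤ) (z : FieldSpace N), β (z + period T k) = β z)
    {D : FiniteChain N n} (hD : D ∈ nullChains T) : chainIntegral β D = 0 := by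
  have : nullChains T ≤ (chainIntegral β).ker := by
    refine (AddSubgroup.closure_le _).2 ?_
    rintro c (⟨σ, hσ, rfl⟩ | ⟨σ, k, rfl⟩)
    · simp [AddMonoidHom.mem_ker, chainIntegral_single, hσ.integral_eq_zero]
    · simp [AddMonoidHom.mem_ker, chainIntegral_single, SmoothCube.integral_translate (hβ k)]
  exact this hD

theorem contourIntegral_finite (β : DiffForm N N) (c : FiniteChain N N) :
    contourIntegral β c = chainIntegral β c := by
  rw [chainIntegral_apply, contourIntegral]
  exact tsum_eq_sum fun σ hσ => by simp [Finsupp.notMem_support_iff.1 hσ]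

theorem absIntegral_finite_lt_top {β : DiffForm N N} (hβ : Continuous β) (c : FiniteChain N N) :
    absIntegral β c < ⊤ := by
  rw [absIntegral, tsum_eq_sum (s := c.support) fun σ hσ => by
    simp [Finsupp.notMem_support_iff.1 hσ]]
  exact ENNReal.sum_lt_top.2 fun σ _ =>
    ENNReal.mul_lt_top (ENNReal.natCast_lt_top _) (SmoothCube.absIntegral_lt_top hβ σ)

theorem absIntegral_add_le (β : DiffForm N N) (γ γ' : Contour N) :
    absIntegral β (γ + γ') ≤ absIntegral β γ + absIntegral β γ' := by
  rw [absIntegral, absIntegral, absIntegral, ← ENNReal.tsum_add]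
  refine ENNReal.tsum_le_tsum fun σ => ?_
  rw [← add_mul]
  gcongr
  exact_mod_cast Int.natAbs_add_le (γ σ) (γ' σ)

theorem absIntegral_mono {β β' : DiffForm N N} (h : ∀ z v, ‖β z v‖ ≤ ‖β' z v‖) (γ : Contour N) :
    absIntegral β γ ≤ absIntegral β' γ :=
  ENNReal.tsum_le_tsum fun σ => mul_le_mul_right (SmoothCube.absIntegral_mono h σ) _

theorem enorm_mul_integral_le (β : DiffForm N N) (γ : Contour N) (σ : SmoothCube N N) :
    ‖(γ σ : ℂ) * σ.integral β‖ₑ ≤ ((γ σ).natAbs : ℝ≥0∞) * σ.absIntegral β := by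
  rw [enorm_mul]
  refine mul_le_mul' (le_of_eq ?_) (SmoothCube.enorm_integral_le β σ)
  rw [← ofReal_norm, Complex.norm_intCast, ← Int.cast_abs, ← Nat.cast_natAbs,
    ENNReal.ofReal_natCast]

theorem tsum_enorm_le_absIntegral (β : DiffForm N N) (γ : Contour N) :
    ∑' σ, ‖(γ σ : ℂ) * σ.integral β‖ₑ ≤ absIntegral β γ :=
  ENNReal.tsum_le_tsum fun σ => enorm_mul_integral_le β γ σ

theorem summable_of_absIntegral_lt_top {β : DiffForm N N} {γ : Contour N}
    (h : absIntegral β γ < ⊤) : Summable fun σ => (γ σ : ℂ) * σ.integral β :=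
  Summable.of_enorm ((tsum_enorm_le_absIntegral β γ).trans_lt h).ne

theorem enorm_contourIntegral_le {β : DiffForm N N} (γ : Contour N) :
    ‖contourIntegral β γ‖ₑ ≤ absIntegral β γ :=
  enorm_tsum_le_tsum_enorm.trans (tsum_enorm_le_absIntegral β γ)

theorem contourIntegral_add {β : DiffForm N N} {γ γ' : Contour N} (h : absIntegral β γ < ⊤)
    (h' : absIntegral β γ' < ⊤) :
    contourIntegral β (γ + γ') = contourIntegral β γ + contourIntegral β γ' := by
  rw [contourIntegral, contourIntegral, contourIntegral, ← Summable.tsum_add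
    (summable_of_absIntegral_lt_top h) (summable_of_absIntegral_lt_top h')]
  simp [add_mul]

/-! ### Invariance under homology. -/

/-- A contour homologous to `γ₀` is `γ₀` plus a finite chain plus a remainder; the finite chain does
not contribute to the integral of an invariant form that satisfies Stokes' theorem. -/
theorem Homologous.exists_decomposition {T : Fin N → ℝ} {B : FieldSpace N → ℂ} {γ γ₀ : Contour N}
    (h : Homologous T B γ γ₀) {ε : ℝ≥0∞} (hε : 0 < ε) :
    ∃ (c : FiniteChain N N) (R : Contour N), γ = γ₀ + c + R ∧ quenchedPartition B R ≤ ε ∧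
      ∀ β : DiffForm N N, (∀ (k : Fin N → ℤ) (z : FieldSpace N), β (z + period T k) = β z) →
        (∀ σ : SmoothCube N (N + 1), chainIntegral β σ.boundary = 0) → chainIntegral β c = 0 := by
  -- Only the size of the remainder matters in the estimates, so `K = ∅` suffices.
  obtain ⟨Ω, D, R, hD, hγ, -, hR⟩ := h ∅ isCompact_empty ε hε
  refine ⟨boundary Ω + D, R, ?_, hR, fun β hβ hs => ?_⟩
  · funext σ
    have := hγ σ
    simp only [Pi.add_apply, Finsupp.coe_add]
    linarith
  · rw [map_add, chainIntegral_boundary hs, chainIntegral_of_mem_nullChains hβ hD, add_zero]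

theorem Homologous.quenchedPartition_lt_top {T : Fin N → ℝ} {B : FieldSpace N → ℂ}
    {γ γ₀ : Contour N} (h : Homologous T B γ γ₀) (hB : Continuous (boltzmannForm B))
    (hγ₀ : quenchedPartition B γ₀ < ⊤) : quenchedPartition B γ < ⊤ := by
  obtain ⟨c, R, rfl, hR, -⟩ := h.exists_decomposition one_pos
  refine (absIntegral_add_le _ _ _).trans_lt (ENNReal.add_lt_top.2 ⟨?_, hR.trans_lt (by simp)⟩)
  exact (absIntegral_add_le _ _ _).trans_lt
    (ENNReal.add_lt_top.2 ⟨hγ₀, absIntegral_finite_lt_top hB c⟩)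

/-- The two integrals differ by `∫_R β`, which domination bounds by `∫_R |ω| ≤ ε` for arbitrary `ε`.
-/
theorem Homologous.contourIntegral_eq {T : Fin N → ℝ} {B : FieldSpace N → ℂ}
    {γ γ₀ : Contour N} (h : Homologous T B γ γ₀) (hγ₀ : quenchedPartition B γ₀ < ⊤)
    {β : DiffForm N N} (hβ : Continuous β)
    (hβT : ∀ (k : Fin N → ℤ) (z : FieldSpace N), β (z + period T k) = β z)
    (hs : ∀ σ : SmoothCube N (N + 1), chainIntegral β σ.boundary = 0)
    (hdom : ∀ (z : FieldSpace N) (v : Fin N → FieldSpace N),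
      ‖β z v‖ ≤ ‖boltzmannForm B z v‖) :
    contourIntegral β γ = contourIntegral β γ₀ := by
  rw [← sub_eq_zero, ← enorm_eq_zero, ← nonpos_iff_eq_zero]
  refine le_of_forall_gt_imp_ge_of_dense fun ε hε => ?_
  -- A finite `ε` makes the integral over `R` absolutely convergent, as additivity of the sums
  -- requires.
  wlog hε' : ε < ⊤ generalizing ε
  · rw [not_lt_top_iff.1 hε']; exact le_top
  obtain ⟨c, R, rfl, hR, hc⟩ := h.exists_decomposition hε
  have h0 : absIntegral β γ₀ < ⊤ := (absIntegral_mono hdom _).trans_lt hγ₀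
  have h1 := absIntegral_finite_lt_top hβ c
  have h2 : absIntegral β R ≤ ε := (absIntegral_mono hdom _).trans hR
  rw [contourIntegral_add ((absIntegral_add_le _ _ _).trans_lt (ENNReal.add_lt_top.2 ⟨h0, h1⟩))
    (h2.trans_lt hε'), contourIntegral_add h0 h1, contourIntegral_finite, hc β hβT hs, add_zero,
    add_sub_cancel_left]
  exact (enorm_contourIntegral_le R).trans h2

end QuenchedBounds

/-! ### The bounds on `Z_Q` and on the average phase. -/

open QuenchedBounds in
theorem mainTheorem1 (N : ℕ) (T : Fin N → ℝ)
    (B : FieldSpace N → ℂ) (hB : Differentiable ℂ B)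
    (hBT : ∀ (k : Fin N → ℤ) (z : FieldSpace N), B (z + period T k) = B z)
    (γ₀ : Contour N) (hγ₀ : quenchedPartition B γ₀ < ⊤)
    (α : DiffForm N N) (hα : Continuous α)
    (hαT : ∀ (k : Fin N → ℤ) (z : FieldSpace N), α (z + period T k) = α z)
    (hclosed : IsClosedForm α)
    (hdom : ∀ (z : FieldSpace N) (v : Fin N → FieldSpace N),
      ‖α z v‖ ≤ ‖boltzmannForm B z v‖) :
    absIntegral α γ₀ < ⊤ ∧
    ∀ γ : Contour N, Homologous T B γ γ₀ →
      quenchedPartition B γ < ⊤ ∧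
      ‖contourIntegral α γ₀‖ ≤ (quenchedPartition B γ).toReal ∧
      partition B γ = partition B γ₀ ∧
      (contourIntegral α γ₀ ≠ 0 →
        ‖averagePhase B γ‖ ≤ ‖partition B γ₀‖ / ‖contourIntegral α γ₀‖) := by
  refine ⟨(absIntegral_mono hdom _).trans_lt hγ₀, fun γ hγ => ?_⟩
  have hωd := differentiable_boltzmannForm hB
  have hZ := hγ.quenchedPartition_lt_top hωd.continuous hγ₀
  have hαγ : contourIntegral α γ = contourIntegral α γ₀ :=
    hγ.contourIntegral_eq hγ₀ hα hαT (chainIntegral_boundary_cube_of_isClosedForm hα hclosed) hdom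
  have hωγ : partition B γ = partition B γ₀ :=
    hγ.contourIntegral_eq hγ₀ hωd.continuous
      (fun k z => by rw [boltzmannForm, boltzmannForm, hBT])
      (chainIntegral_boundary_cube_of_extDeriv_eq_zero hωd (extDeriv_boltzmannForm hB))
      fun _ _ => le_rfl
  have hle : ‖contourIntegral α γ₀‖ ≤ (quenchedPartition B γ).toReal := by
    -- The integral of `α` is moved to `γ` before absolute values are taken.
    rw [← hαγ, ← toReal_enorm]
    exact ENNReal.toReal_mono hZ.ne ((enorm_contourIntegral_le γ).trans (absIntegral_mono hdom γ))
  refine ⟨hZ, hle, hωγ, fun hne => ?_⟩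
  rw [averagePhase, hωγ, norm_div, Complex.norm_real, Real.norm_of_nonneg ENNReal.toReal_nonneg]
  exact div_le_div_of_nonneg_left (norm_nonneg _) (norm_pos_iff.2 hne) hle
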